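/- Let $\mathbb K=\mathbb R$ or $\mathbb C$. A \emph{sequence class} $X$ assigns to each Banach space $E$ over $\mathbb K$ a Banach space $X(E)$ of $E$-valued sequences (with coordinatewise operations) such that $c_{00}(E)\subseteq X(E)\subseteq \ell_\infty(E)$, $\|x\|_\infty\le\|x\|_{X(E)}$ for all $x\in X(E)$, and $\|e_j\|_{X(\mathbb K)}=1$ for every $j\in\mathbb N$. All sequence classes are assumed \emph{linearly stable}: for all Banach spaces $E,F$ and every bounded linear $T\colon E\to F$, $(T(x_j))_j\in X(F)$ whenever $(x_j)_j\in X(E)$, and the induced operator $X(E)\to X(F)$ has norm $\|T\|$. For a sequence $x=(x_j)_j$ let $(x_j)_{j\ne k}=(x_1,\dots,x_{k-1},x_{k+1},\dots)$. A sequence class $X$ is called - \emph{finitely injective} if $\|(x_j)_{j=1}^n\|_{X(E)}\le\|(i(x_j))_{j=1}^n\|_{X(F)}$ for every linear isometric embedding $i\colon E\to F$ of Banach spaces, all $n\in\mathbb N$ and $x_1,\dots,x_n\in E$ (finite sequences are extended by zeros); - \emph{finitely shrinking} if for every $E$, $x\in X(E)$ and $k\in\mathbb N$ we have $(x_j)_{j\ne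 k}\in X(E)$ and $\|(x_j)_{j\ne k}\|_{X(E)}\le\|x\|_{X(E)}$; - \emph{finitely zero invariant} if for every $E$, every sequence $x$ in $E$ and every $k$ with $x_k=0$ we have $x\in X(E)\Leftrightarrow (x_j)_{j\ne k}\in X(E)$, and in this case $\|x\|_{X(E)}=\|(x_j)_{j\ne k}\|_{X(E)}$; - \emph{spherically complete} if for every $E$, $(x_j)_j\in X(E)$ and scalars $\alpha_j$ with $|\alpha_j|=1$ for all $j$, we have $(\alpha_jx_j)_j\in X(E)$ and $\|(\alpha_jx_j)_j\|_{X(E)}=\|(x_j)_j\|_{X(E)}$. Let $1\le p<\infty$ and $\frac1p+\frac1{p^*}=1$. For a Banach space $F$, $\ell_{p^*}^w(F)$ is the space of sequences $(y_j)_j$ in $F$ with $(\varphi(y_j))_j\in\ell_{p^*}$ for all $\varphi\in F^*$, normed by $\sup_{\|\varphi\|\le1}\|(\varphi(y_j))_j\|_{p^*}$. The space $\ell_p\langle E\rangle$ of Cohen strongly $p$-summable sequences consists of the sequences $(x_j)_j$ in $E$ with $\sum_j|x_j^*(x_j)|<\infty$ for all $(x_j^*)_j\in\ell_{p^*}^w(E^*)$,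 normed by $\|(x_j)_j\|_{\ell_p\langle E\rangle}=\sup\sum_j|x_j^*(x_j)|$, the supremum being over the closed unit ball of $\ell_{p^*}^w(E^*)$. \textbf{Proposition.} Let $1\le p<\infty$ and let $X$ be a (linearly stable) sequence class that is finitely injective, finitely zero invariant, finitely shrinking and spherically complete. Suppose that $X(\mathbb K)=\ell_p$ with equality of norms, and that for every Banach space $E$ we have $X(E)\subseteq\ell_p\langle E\rangle$ with $\|\cdot\|_{\ell_p\langle E\rangle}\le\|\cdot\|_{X(E)}$ on $X(E)$. Then $X(E)=\ell_p\langle E\rangle$ with equality of norms for every Banach space $E$. -/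

import Mathlib

open Filter Topology
open scoped ENNReal

universe u

/-- The sequence `e_j ⊗ v`, with `v` in position `j` and zeros elsewhere. -/
noncomputable def unitSeq {E : Type*} [Zero E] (j : ℕ) (v : E) : ℕ → E := Pi.single j v

/-- The sequence obtained from `x` by deleting its `k`-th term and shifting the later ones. -/
def deleteTerm {E : Type*} (k : ℕ) (x : ℕ → E) : ℕ → E :=
  fun j => if j < k then x j else x (j + 1)

/-- A sequence class over `𝕜 = ℝ` or `ℂ`: to each Banach space `E` it assigns a Banach space
`X(E)` of `E`-valued sequences with `c₀₀(E) ⊆ X(E)`, with `X(E)` contained in `ℓ_∞(E)` with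
inclusion of norm at most `1`, and with `‖e_j‖_{X(𝕜)} = 1` for every `j`. The seminorm on `X(E)`
is a norm because of `norm_apply_le`. -/
structure SequenceClass (𝕜 : Type u) [RCLike 𝕜] where
  /-- the vector space underlying `X(E)` -/
  space (E : Type u) [NormedAddCommGroup E] [NormedSpace 𝕜 E] [CompleteSpace E] :
    Submodule 𝕜 (ℕ → E)
  /-- the norm of `X(E)` -/
  nrm (E : Type u) [NormedAddCommGroup E] [NormedSpace 𝕜 E] [CompleteSpace E] :
    Seminorm 𝕜 (space E)
  /-- `X(E)` is complete -/
  complete (E : Type u) [NormedAddCommGroup E] [NormedSpace 𝕜 E] [CompleteSpace E]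
    (s : ℕ → space E) (hs : ∀ ε > 0, ∃ N, ∀ m ≥ N, ∀ n ≥ N, nrm E (s m - s n) < ε) :
    ∃ x : space E, Tendsto (fun n => nrm E (s n - x)) atTop (𝓝 0)
  /-- `X(E)` contains all eventually null sequences -/
  finite_mem (E : Type u) [NormedAddCommGroup E] [NormedSpace 𝕜 E] [CompleteSpace E]
    (x : ℕ → E) (hx : (Function.support x).Finite) : x ∈ space E
  /-- `X(E)` is contained in `ℓ_∞(E)`, with `‖x‖_∞ ≤ ‖x‖_{X(E)}` -/
  norm_apply_le (E : Type u) [NormedAddCommGroup E] [NormedSpace 𝕜 E] [CompleteSpace E]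
    (x : space E) (j : ℕ) : ‖(x : ℕ → E) j‖ ≤ nrm E x
  /-- `‖e_j‖_{X(𝕜)} = 1` -/
  nrm_unit (j : ℕ) (h : unitSeq j (1 : 𝕜) ∈ space 𝕜) : nrm 𝕜 ⟨unitSeq j (1 : 𝕜), h⟩ = 1

namespace SequenceClass

variable {𝕜 : Type u} [RCLike 𝕜]

/-- Linear stability: every continuous linear `T : E → F` maps `X(E)` into `X(F)` coordinatewise,
and the induced operator `X(E) → X(F)` has norm exactly `‖T‖`. -/
def LinearlyStable (X : SequenceClass 𝕜) : Prop :=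
  ∀ (E F : Type u) [NormedAddCommGroup E] [NormedSpace 𝕜 E] [CompleteSpace E]
    [NormedAddCommGroup F] [NormedSpace 𝕜 F] [CompleteSpace F] (T : E →L[𝕜] F),
    ∃ hT : ∀ x : X.space E, (fun j => T ((x : ℕ → E) j)) ∈ X.space F,
      IsLeast {C : ℝ | 0 ≤ C ∧ ∀ x : X.space E, X.nrm F ⟨_, hT x⟩ ≤ C * X.nrm E x} ‖T‖

/-- `‖(x_j)_{j ≤ n}‖_{X(E)} ≤ ‖(i(x_j))_{j ≤ n}‖_{X(F)}` for all finite sequences and all linear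
isometric embeddings `i : E → F` (metric injections). -/
def FinitelyInjective (X : SequenceClass 𝕜) : Prop :=
  ∀ (E F : Type u) [NormedAddCommGroup E] [NormedSpace 𝕜 E] [CompleteSpace E]
    [NormedAddCommGroup F] [NormedSpace 𝕜 F] [CompleteSpace F] (i : E →ₗᵢ[𝕜] F)
    (x : ℕ → E), (Function.support x).Finite →
    ∀ (hx : x ∈ X.space E) (hix : (fun j => i (x j)) ∈ X.space F),
      X.nrm E ⟨x, hx⟩ ≤ X.nrm F ⟨_, hix⟩

/-- Deleting one term keeps a sequence in `X(E)` and does not increase its norm. -/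
def FinitelyShrinking (X : SequenceClass 𝕜) : Prop :=
  ∀ (E : Type u) [NormedAddCommGroup E] [NormedSpace 𝕜 E] [CompleteSpace E]
    (x : X.space E) (k : ℕ),
    ∃ h : deleteTerm k (x : ℕ → E) ∈ X.space E, X.nrm E ⟨_, h⟩ ≤ X.nrm E x

/-- Deleting a zero term affects neither membership in `X(E)` nor the norm. -/
def FinitelyZeroInvariant (X : SequenceClass 𝕜) : Prop :=
  ∀ (E : Type u) [NormedAddCommGroup E] [NormedSpace 𝕜 E] [CompleteSpace E]
    (x : ℕ → E) (k : ℕ), x k = 0 →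
    (x ∈ X.space E ↔ deleteTerm k x ∈ X.space E) ∧
    ∀ (hx : x ∈ X.space E) (hd : deleteTerm k x ∈ X.space E),
      X.nrm E ⟨x, hx⟩ = X.nrm E ⟨_, hd⟩

/-- Multiplying the terms by scalars of modulus `1` keeps a sequence in `X(E)` and preserves its
norm. -/
def SphericallyComplete (X : SequenceClass 𝕜) : Prop :=
  ∀ (E : Type u) [NormedAddCommGroup E] [NormedSpace 𝕜 E] [CompleteSpace E]
    (x : X.space E) (α : ℕ → 𝕜), (∀ j, ‖α j‖ = 1) →
    ∃ h : (fun j => α j • (x : ℕ → E) j) ∈ X.space E, X.nrm E ⟨_, h⟩ = X.nrm E x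

/-- `X(𝕜) = ℓ_p` as Banach spaces: the same sequences with the same norm. -/
def HasScalarComponentLp (X : SequenceClass 𝕜) (p : ℝ≥0∞) : Prop :=
  ∀ a : ℕ → 𝕜, (a ∈ X.space 𝕜 ↔ Memℓp a p) ∧
    ∀ (ha : a ∈ X.space 𝕜) (hp : Memℓp a p),
      X.nrm 𝕜 ⟨a, ha⟩ = ‖(⟨a, hp⟩ : lp (fun _ : ℕ => 𝕜) p)‖

end SequenceClass

section Cohen

variable (𝕜 : Type u) [RCLike 𝕜]

/-- `ℓ_q^w(F)`: the weakly `q`-summable sequences in `F`. -/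
def weakLp (q : ℝ≥0∞) (F : Type u) [NormedAddCommGroup F] [NormedSpace 𝕜 F] : Set (ℕ → F) :=
  {y | ∀ φ : StrongDual 𝕜 F, Memℓp (fun j => φ (y j)) q}

/-- The closed unit ball of `ℓ_q^w(F)` for its norm `sup_{‖φ‖ ≤ 1} ‖(φ(y_j))_j‖_q`. -/
def weakLpUnitBall (q : ℝ≥0∞) (F : Type u) [NormedAddCommGroup F] [NormedSpace 𝕜 F] :
    Set (ℕ → F) :=
  {y | ∀ φ : StrongDual 𝕜 F, ‖φ‖ ≤ 1 →
    ∃ h : Memℓp (fun j => φ (y j)) q, ‖(⟨_, h⟩ : lp (fun _ : ℕ => 𝕜) q)‖ ≤ 1}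

/-- `ℓ_p⟨E⟩`: the Cohen strongly `p`-summable sequences in `E`, that is, those `x` such that
`∑ |x_j^*(x_j)| < ∞` for all `(x_j^*) ∈ ℓ_{p^*}^w(E^*)`. -/
def cohen (p : ℝ≥0∞) (E : Type u) [NormedAddCommGroup E] [NormedSpace 𝕜 E] : Set (ℕ → E) :=
  {x | ∀ y ∈ weakLp 𝕜 p.conjExponent (StrongDual 𝕜 E), Summable fun j => ‖y j (x j)‖}

/-- The norm of `ℓ_p⟨E⟩`, the supremum of `∑ |x_j^*(x_j)|` over the unit ball of
`ℓ_{p^*}^w(E^*)`, as an extended nonnegative real. -/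
noncomputable def cohenNorm (p : ℝ≥0∞) {E : Type u} [NormedAddCommGroup E] [NormedSpace 𝕜 E]
    (x : ℕ → E) : ℝ≥0∞ :=
  ⨆ y ∈ weakLpUnitBall 𝕜 p.conjExponent (StrongDual 𝕜 E), ∑' j, ‖y j (x j)‖ₑ

variable {𝕜}

/-- `X(E) ⊆ ℓ_p⟨E⟩` with `‖x‖_{ℓ_p⟨E⟩} ≤ ‖x‖_{X(E)}`, for every Banach space `E`. -/
def SequenceClass.EmbedsInCohen (X : SequenceClass 𝕜) (p : ℝ≥0∞) : Prop :=
  ∀ (E : Type u) [NormedAddCommGroup E] [NormedSpace 𝕜 E] [CompleteSpace E] (x : X.space E),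
    (x : ℕ → E) ∈ cohen 𝕜 p E ∧ cohenNorm 𝕜 p (x : ℕ → E) ≤ ENNReal.ofReal (X.nrm E x)

/-- `X(E) = ℓ_p⟨E⟩` with equality of norms, for every Banach space `E`. -/
def SequenceClass.EqCohen (X : SequenceClass 𝕜) (p : ℝ≥0∞) : Prop :=
  ∀ (E : Type u) [NormedAddCommGroup E] [NormedSpace 𝕜 E] [CompleteSpace E],
    (X.space E : Set (ℕ → E)) = cohen 𝕜 p E ∧
    ∀ x : X.space E, ENNReal.ofReal (X.nrm E x) = cohenNorm 𝕜 p (x : ℕ → E)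

end Cohen

/-! The point is that `X(E)` has the largest norm compatible with its scalar component. Applying
linear stability to `a ↦ a • v` gives `‖(a_j v)_j‖_{X(E)} ≤ ‖a‖_p ‖v‖` for finite `a`. Given a
finite `x`, take by Hahn–Banach a functional `f` dominated by the norm of `X(E)` and norming `x`,
and let `y_j` be its restriction to the `j`-th coordinate. The bound says `‖∑ a_j y_j‖ ≤ 1` whenever
`‖a‖_p ≤ 1`, so by scalar duality `(y_j)` is in the unit ball of `ℓ_{p*}^w(E*)`, and `‖x‖_{X(E)} =
|∑ y_j(x_j)|` is at most the Cohen norm (`nrm_sum_single_le`).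

To pass to infinite sequences, a gliding hump argument shows that Cohen tails are uniformly small
(`exists_forall_sum_norm_apply_le_of_mem_cohen`). Truncations are then Cauchy in `X(E)` and converge
to the sequence itself. The assumed embedding supplies the reverse inclusion and inequality. -/

section Scalar

variable {𝕜 : Type*} [RCLike 𝕜]

/-- If `b` pairs with the finitely supported part of the unit ball of `ℓ_p` to scalars of modulus
at most `1`, then `b` lies in the unit ball of `ℓ_q`, for conjugate `p < ∞` and `q`. -/
theorem exists_memℓp_norm_le_one_of_forall_sum_mul_le {p q : ℝ≥0∞} [hpq : p.HolderConjugate q]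
    (hp : p ≠ ∞) {b : ℕ → 𝕜}
    (hb : ∀ (s : Finset ℕ) (a : ℕ → 𝕜), ∑ j ∈ s, ‖a j‖ ^ p.toReal ≤ 1 →
      ‖∑ j ∈ s, a j * b j‖ ≤ 1) :
    ∃ h : Memℓp b q, ‖(⟨b, h⟩ : lp (fun _ : ℕ => 𝕜) q)‖ ≤ 1 := by
  by_cases hq : q = ∞
  · subst hq
    have hle : ∀ j, ‖b j‖ ≤ 1 := fun j => by simpa using hb {j} (fun _ => 1) (by simp)
    exact ⟨memℓp_infty ⟨1, by rintro _ ⟨j, rfl⟩; exact hle j⟩,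
      lp.norm_le_of_forall_le zero_le_one hle⟩
  have hR : p.toReal.HolderConjugate q.toReal := ENNReal.HolderConjugate.toReal_of_ne_top hp hq
  have hsum : ∀ s : Finset ℕ, ∑ j ∈ s, ‖b j‖ ^ q.toReal ≤ 1 := by
    intro s
    -- Test against the extremizer `g` of Hölder's inequality for `|b|`, with phases `u j` making
    -- each product nonnegative.
    obtain ⟨g, hg, hgs⟩ := (NNReal.isGreatest_Lp s (fun j => ‖b j‖₊) hR.symm).1
    choose u hu hub using fun j => RCLike.exists_norm_eq_mul_self (b j)
    have key := hb s (fun j => ((g j : ℝ) : 𝕜) * u j) (by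
      simp only [norm_mul, hu, mul_one, RCLike.norm_ofReal, NNReal.abs_eq]
      exact_mod_cast hg)
    have hval : ∑ j ∈ s, ((g j : ℝ) : 𝕜) * u j * b j
        = ((∑ j ∈ s, ‖b j‖₊ * g j : NNReal) : ℝ) := by
      push_cast
      refine Finset.sum_congr rfl fun j _ => ?_
      rw [mul_assoc, ← hub, mul_comm]
    rw [hval, RCLike.norm_ofReal, NNReal.abs_eq] at key
    have hroot : (∑ j ∈ s, ‖b j‖₊ ^ q.toReal) ^ (1 / q.toReal) ≤ 1 := by
      rw [← hgs]; exact_mod_cast key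
    have hpow := NNReal.rpow_le_rpow hroot hR.symm.nonneg
    rw [← NNReal.rpow_mul, one_div, inv_mul_cancel₀ hR.symm.ne_zero, NNReal.rpow_one,
      NNReal.one_rpow] at hpow
    simpa using NNReal.coe_le_coe.2 hpow
  exact ⟨memℓp_gen' hsum, lp.norm_le_of_forall_sum_le hR.symm.pos zero_le_one
    fun s => by simpa using hsum s⟩

end Scalar

section SeminormDual

/-- Every vector is normed by a linear functional dominated by the seminorm. -/
theorem Seminorm.exists_linearMap_norm_le_apply_eq {𝕜 V : Type*} [RCLike 𝕜] [AddCommGroup V]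
    [Module 𝕜 V] (N : Seminorm 𝕜 V) (x : V) :
    ∃ f : V →ₗ[𝕜] 𝕜, (∀ v, ‖f v‖ ≤ N v) ∧ ‖f x‖ = N x := by
  let : SeminormedAddCommGroup V := N.toAddGroupSeminorm.toSeminormedAddCommGroup
  have hN : ∀ v : V, ‖v‖ = N v := fun _ => rfl
  let : NormedSpace 𝕜 V := ⟨fun c v => (map_smul_eq_mul N c v).le⟩
  obtain ⟨g, hg, hgx⟩ := exists_dual_vector'' 𝕜 x
  refine ⟨g.toLinearMap, fun v => ?_, ?_⟩
  · simpa [hN] using g.le_of_opNorm_le hg v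
  · have : ‖g x‖ = N x := by rw [hgx]; simp [hN]
    exact this

end SeminormDual

/-! ### Gluing weakly summable sequences. -/

section WeakSequences

variable {𝕜 : Type u} [RCLike 𝕜] {F : Type u} [NormedAddCommGroup F] [NormedSpace 𝕜 F]

theorem mem_weakLp_of_forall_norm_le_one {q : ℝ≥0∞} {y : ℕ → F}
    (hy : ∀ φ : StrongDual 𝕜 F, ‖φ‖ ≤ 1 → Memℓp (fun j => φ (y j)) q) : y ∈ weakLp 𝕜 q F := by
  intro φ
  have hc : (0 : ℝ) < ‖φ‖ + 1 := by positivity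
  have hc' : ((‖φ‖ + 1 : ℝ) : 𝕜) ≠ 0 := by exact_mod_cast hc.ne'
  have h := (hy ((((‖φ‖ + 1 : ℝ) : 𝕜))⁻¹ • φ) (by
    rw [norm_smul, norm_inv, RCLike.norm_ofReal, abs_of_pos hc, inv_mul_le_iff₀ hc]
    linarith)).const_mul (((‖φ‖ + 1 : ℝ) : 𝕜))
  convert h using 2 with j
  rw [smul_apply, smul_eq_mul, mul_inv_cancel_left₀ hc']

/-- Choosing each term from one of countably many sequences in the unit ball of `ℓ_q^w(F)`, with
weight `1 / (k + 1)` for the `k`-th of them, gives a sequence in `ℓ_q^w(F)` if `1 < q`. -/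
theorem smul_comp_mem_weakLp {q : ℝ≥0∞} (hq : 1 < q) {y : ℕ → ℕ → F}
    (hy : ∀ k, y k ∈ weakLpUnitBall 𝕜 q F) (κ : ℕ → ℕ) :
    (fun j => ((κ j : 𝕜) + 1)⁻¹ • y (κ j) j) ∈ weakLp 𝕜 q F := by
  refine mem_weakLp_of_forall_norm_le_one fun φ hφ => ?_
  have hw : ∀ k : ℕ, ‖((k : 𝕜) + 1)⁻¹‖ = ((k : ℝ) + 1)⁻¹ := fun k => by
    rw [norm_inv, ← Nat.cast_succ, RCLike.norm_natCast, Nat.cast_succ]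
  simp only [map_smul, smul_eq_mul]
  by_cases hq' : q = ∞
  · subst hq'
    refine memℓp_infty ⟨1, ?_⟩
    rintro _ ⟨j, rfl⟩
    obtain ⟨h, h1⟩ := hy (κ j) φ hφ
    have hj : ‖φ (y (κ j) j)‖ ≤ 1 := (lp.norm_apply_le_norm ENNReal.top_ne_zero _ j).trans h1
    simp only [norm_mul, hw]
    exact mul_le_one₀ (inv_le_one_of_one_le₀ (by simp)) (norm_nonneg _) hj
  have hq1 : 1 < q.toReal := by
    simpa using (ENNReal.toReal_lt_toReal ENNReal.one_ne_top hq').2 hq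
  have hq0 : 0 < q.toReal := zero_lt_one.trans hq1
  have hbl : ∀ k (s : Finset ℕ), ∑ j ∈ s, ‖φ (y k j)‖ ^ q.toReal ≤ 1 := fun k s => by
    obtain ⟨h, h1⟩ := hy k φ hφ
    exact (lp.sum_rpow_le_norm_rpow hq0 ⟨_, h⟩ s).trans
      (Real.rpow_le_one (lp.norm_nonneg' _) h1 hq0.le)
  have hsum : Summable fun k : ℕ => (((k : ℝ) + 1)⁻¹) ^ q.toReal := by
    have := (summable_nat_add_iff 1).2 (Real.summable_nat_rpow_inv.2 hq1)
    refine this.congr fun k => ?_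
    rw [Real.inv_rpow (by positivity), Nat.cast_succ]
  refine memℓp_gen' (C := ∑' k : ℕ, (((k : ℝ) + 1)⁻¹) ^ q.toReal) fun s => ?_
  -- The indices with `κ j = k` contribute at most `(k + 1)⁻¹ ^ q`, which is summable over `k`
  -- because `1 < q`.
  rw [← Finset.sum_fiberwise_of_maps_to (t := s.image κ) fun j hj => Finset.mem_image_of_mem κ hj]
  refine le_trans (Finset.sum_le_sum fun k _ => ?_)
    (hsum.sum_le_tsum (s.image κ) fun k _ => by positivity)
  calc ∑ j ∈ s with κ j = k, ‖((κ j : 𝕜) + 1)⁻¹ * φ (y (κ j) j)‖ ^ q.toReal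
      = (((k : ℝ) + 1)⁻¹) ^ q.toReal * ∑ j ∈ s with κ j = k, ‖φ (y k j)‖ ^ q.toReal := by
        rw [Finset.mul_sum]
        refine Finset.sum_congr rfl fun j hj => ?_
        rw [(Finset.mem_filter.1 hj).2, norm_mul, hw, Real.mul_rpow (by positivity) (norm_nonneg _)]
    _ ≤ (((k : ℝ) + 1)⁻¹) ^ q.toReal :=
        mul_le_of_le_one_right (by positivity) (hbl k _)

end WeakSequences

/-! ### Uniform smallness of Cohen tails. -/

section CohenTails

variable {𝕜 : Type u} [RCLike 𝕜] {E : Type u} [NormedAddCommGroup E] [NormedSpace 𝕜 E]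

theorem one_lt_conjExponent {p : ℝ≥0∞} (hp : p ≠ ∞) : 1 < p.conjExponent :=
  ENNReal.lt_add_right ENNReal.one_ne_top (ENNReal.inv_ne_zero.2 (ENNReal.sub_ne_top hp))

/-- The tails of a Cohen strongly `p`-summable sequence tend to `0` in the Cohen norm. -/
theorem exists_forall_sum_norm_apply_le_of_mem_cohen {p : ℝ≥0∞} (hp : p ≠ ∞) {x : ℕ → E}
    (hx : x ∈ cohen 𝕜 p E) {ε : ℝ} (hε : 0 < ε) :
    ∃ N : ℕ, ∀ s : Finset ℕ, (∀ j ∈ s, N ≤ j) →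
      ∀ y ∈ weakLpUnitBall 𝕜 p.conjExponent (StrongDual 𝕜 E), ∑ j ∈ s, ‖y j (x j)‖ ≤ ε := by
  by_contra! hcon
  -- Gliding hump: each bad block is chosen beyond all earlier ones.
  obtain ⟨f, hf, hdis⟩ := exists_seq_of_forall_finset_exists
    (fun z : Finset ℕ × (ℕ → StrongDual 𝕜 E) =>
      z.2 ∈ weakLpUnitBall 𝕜 p.conjExponent (StrongDual 𝕜 E) ∧ ε < ∑ j ∈ z.1, ‖z.2 j (x j)‖)
    (fun z w => Disjoint z.1 w.1) (fun S _ => by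
      obtain ⟨s, hs, y, hy, hlt⟩ := hcon ((S.sup fun z => z.1.sup id) + 1)
      refine ⟨(s, y), ⟨hy, hlt⟩, fun z hz => Finset.disjoint_left.2 fun j hj hjs => ?_⟩
      have h1 : j ≤ z.1.sup id := Finset.le_sup (f := id) hj
      have h2 : z.1.sup id ≤ S.sup fun z => z.1.sup id :=
        Finset.le_sup (f := fun z : Finset ℕ × (ℕ → StrongDual 𝕜 E) => z.1.sup id) hz
      have h3 := hs j hjs
      omega)
  have hpair : Pairwise fun k l => Disjoint (f k).1 (f l).1 := fun k l hkl =>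
    (lt_or_gt_of_ne hkl).elim (hdis k l) fun h => (hdis l k h).symm
  obtain ⟨κ, hκ⟩ : ∃ κ : ℕ → ℕ, ∀ k, ∀ j ∈ (f k).1, κ j = k := by
    -- Off the blocks `sInf ∅ = 0`; the gluing lemma accepts any value there.
    refine ⟨fun j => sInf {k | j ∈ (f k).1}, fun k j hj => ?_⟩
    by_contra hne
    exact Finset.disjoint_left.1 (hpair hne) (Nat.sInf_mem (s := {k | j ∈ (f k).1}) ⟨k, hj⟩) hj
  have hsum := hx _ (smul_comp_mem_weakLp (one_lt_conjExponent hp) (fun k => (hf k).1) κ)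
  -- The `k`-th block adds more than `ε / (k + 1)` to the convergent pairing of `x` with the glued
  -- sequence, so the harmonic series would converge.
  have hharm : Summable fun k : ℕ => ((k : ℝ) + 1)⁻¹ * ε := by
    refine summable_of_sum_range_le (fun k => by positivity) fun n =>
      le_trans ?_ (hsum.sum_le_tsum ((Finset.range n).biUnion fun k => (f k).1)
        fun j _ => norm_nonneg _)
    rw [Finset.sum_biUnion fun k _ l _ hkl => hpair hkl]
    refine Finset.sum_le_sum fun k _ => ?_
    calc ((k : ℝ) + 1)⁻¹ * ε ≤ ((k : ℝ) + 1)⁻¹ * ∑ j ∈ (f k).1, ‖(f k).2 j (x j)‖ := by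
          gcongr
          exact (hf k).2.le
      _ = _ := by
          rw [Finset.mul_sum]
          refine Finset.sum_congr rfl fun j hj => ?_
          rw [hκ k j hj, smul_apply, norm_smul, norm_inv]
          rw [← Nat.cast_succ (R := 𝕜), RCLike.norm_natCast, Nat.cast_succ]
  rw [summable_mul_right_iff hε.ne'] at hharm
  refine Real.not_summable_natCast_inv ((summable_nat_add_iff 1).1 ?_)
  simpa using hharm

theorem sum_norm_apply_le_of_cohenNorm_ne_top {p : ℝ≥0∞} {x : ℕ → E} (hx : cohenNorm 𝕜 p x ≠ ∞)
    (s : Finset ℕ) {y : ℕ → StrongDual 𝕜 E}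
    (hy : y ∈ weakLpUnitBall 𝕜 p.conjExponent (StrongDual 𝕜 E)) :
    ∑ j ∈ s, ‖y j (x j)‖ ≤ (cohenNorm 𝕜 p x).toReal := by
  rw [← ENNReal.ofReal_le_iff_le_toReal hx, ENNReal.ofReal_sum_of_nonneg fun j _ => norm_nonneg _]
  simp only [ofReal_norm]
  exact (ENNReal.sum_le_tsum s).trans
    (le_iSup₂ (f := fun y (_ : y ∈ weakLpUnitBall 𝕜 p.conjExponent (StrongDual 𝕜 E)) =>
      ∑' j, ‖y j (x j)‖ₑ) y hy)

end CohenTails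

/-! ### Comparison of `X(E)` with the Cohen class. -/

namespace SequenceClass

variable {𝕜 : Type u} [RCLike 𝕜] (X : SequenceClass 𝕜) {E : Type u} [NormedAddCommGroup E]
  [NormedSpace 𝕜 E] [CompleteSpace E]

/-- The map `v ↦ e_j ⊗ v` into `X(E)`. -/
noncomputable def single (j : ℕ) : E →ₗ[𝕜] X.space E :=
  (LinearMap.single 𝕜 (fun _ : ℕ => E) j).codRestrict (X.space E) fun _ =>
    X.finite_mem E _ ((Set.finite_singleton j).subset Pi.support_single_subset)

theorem coe_sum_single_apply (s : Finset ℕ) (x : ℕ → E) (i : ℕ) :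
    ((∑ j ∈ s, X.single j (x j) : X.space E) : ℕ → E) i = if i ∈ s then x i else 0 := by
  simp [single, Finset.sum_apply, Pi.single_apply]

variable {X}

/-- The sequence is the image of `(a_j)` under the operator `c ↦ c • v` from `𝕜` to `E`, whose norm
is `‖v‖`. -/
theorem nrm_sum_single_smul_le (hstable : X.LinearlyStable) {p : ℝ≥0∞} (hp1 : 1 ≤ p) (hp : p ≠ ∞)
    (hscalar : X.HasScalarComponentLp p) (s : Finset ℕ) (a : ℕ → 𝕜)
    (ha : ∑ j ∈ s, ‖a j‖ ^ p.toReal ≤ 1) (v : E) :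
    X.nrm E (∑ j ∈ s, X.single j (a j • v)) ≤ ‖v‖ := by
  have hp0 : 0 < p.toReal := ENNReal.toReal_pos (zero_lt_one.trans_le hp1).ne' hp
  set z : X.space 𝕜 := ∑ j ∈ s, X.single j (a j) with hz
  have hz1 : X.nrm 𝕜 z ≤ 1 := by
    have hmem := ((hscalar z).1).1 z.2
    have heq : X.nrm 𝕜 z = _ := (hscalar z).2 z.2 hmem
    rw [heq]
    refine lp.norm_le_of_forall_sum_le hp0 zero_le_one fun t => ?_
    rw [Real.one_rpow]
    refine le_trans ?_ ha
    calc ∑ i ∈ t, ‖(z : ℕ → 𝕜) i‖ ^ p.toReal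
        = ∑ i ∈ t, if i ∈ s then ‖a i‖ ^ p.toReal else 0 := by
          refine Finset.sum_congr rfl fun i _ => ?_
          rw [hz, coe_sum_single_apply]
          split_ifs
          · rfl
          · rw [norm_zero, Real.zero_rpow hp0.ne']
      _ = ∑ i ∈ t ∩ s, ‖a i‖ ^ p.toReal := by rw [Finset.sum_ite_mem]
      _ ≤ _ := Finset.sum_le_sum_of_subset_of_nonneg Finset.inter_subset_right
          fun i _ _ => by positivity
  obtain ⟨hT, hleast⟩ := hstable 𝕜 E (ContinuousLinearMap.toSpanSingleton 𝕜 v)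
  have h := hleast.1.2 z
  rw [ContinuousLinearMap.norm_toSpanSingleton] at h
  have heq : (⟨_, hT z⟩ : X.space E) = ∑ j ∈ s, X.single j (a j • v) := by
    ext i
    rw [coe_sum_single_apply, hz]
    simp only [coe_sum_single_apply, ContinuousLinearMap.toSpanSingleton_apply]
    split_ifs <;> simp
  rw [heq] at h
  exact h.trans (mul_le_of_le_one_right (norm_nonneg v) hz1)

/-- On finite sequences the norm of `X(E)` is at most the Cohen norm. -/
theorem nrm_sum_single_le (hstable : X.LinearlyStable) {p : ℝ≥0∞} (hp1 : 1 ≤ p) (hp : p ≠ ∞)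
    (hscalar : X.HasScalarComponentLp p) (s : Finset ℕ) (x : ℕ → E) {C : ℝ}
    (hC : ∀ y ∈ weakLpUnitBall 𝕜 p.conjExponent (StrongDual 𝕜 E), ∑ j ∈ s, ‖y j (x j)‖ ≤ C) :
    X.nrm E (∑ j ∈ s, X.single j (x j)) ≤ C := by
  obtain ⟨f, hf, hfx⟩ := (X.nrm E).exists_linearMap_norm_le_apply_eq (∑ j ∈ s, X.single j (x j))
  have hbound : ∀ (t : Finset ℕ) (a : ℕ → 𝕜), ∑ j ∈ t, ‖a j‖ ^ p.toReal ≤ 1 → ∀ v : E,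
      ‖∑ j ∈ t, a j * f (X.single j v)‖ ≤ ‖v‖ := fun t a ha v => by
    have h := (hf _).trans (nrm_sum_single_smul_le hstable hp1 hp hscalar t a ha v)
    simpa [map_sum, map_smul] using h
  let y : ℕ → StrongDual 𝕜 E := fun j => (f ∘ₗ X.single j).mkContinuous 1 fun v => by
    simpa using hbound {j} (fun _ => 1) (by simp) v
  -- `∑ a_j y_j` is `v ↦ f (∑ e_j ⊗ a_j v)`, of norm at most `1`; apply `φ` and use scalar duality.
  have hy : y ∈ weakLpUnitBall 𝕜 p.conjExponent (StrongDual 𝕜 E) := fun φ hφ => by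
    have : p.HolderConjugate p.conjExponent := .conjExponent hp1
    refine exists_memℓp_norm_le_one_of_forall_sum_mul_le (p := p) hp fun t a ha => ?_
    have hnorm : ‖∑ j ∈ t, a j • y j‖ ≤ 1 :=
      ContinuousLinearMap.opNorm_le_bound _ zero_le_one fun v => by
        simpa [y, sum_apply] using hbound t a ha v
    have hφy : ∑ j ∈ t, a j * φ (y j) = φ (∑ j ∈ t, a j • y j) := by simp [map_sum]
    rw [hφy]
    exact (φ.le_of_opNorm_le hφ _).trans (by simpa using hnorm)
  rw [← hfx, map_sum]
  exact (norm_sum_le _ _).trans (hC y hy)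

/-- The Cohen sequences belong to `X(E)`, as limits of their truncations. -/
theorem exists_tendsto_nrm_truncation (hstable : X.LinearlyStable) {p : ℝ≥0∞} (hp1 : 1 ≤ p)
    (hp : p ≠ ∞) (hscalar : X.HasScalarComponentLp p) {x : ℕ → E} (hx : x ∈ cohen 𝕜 p E) :
    ∃ h : x ∈ X.space E, Tendsto
      (fun n => X.nrm E ((∑ j ∈ Finset.range n, X.single j (x j)) - ⟨x, h⟩)) atTop (𝓝 0) := by
  obtain ⟨z, hz⟩ := X.complete E (fun n => ∑ j ∈ Finset.range n, X.single j (x j)) (by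
    intro ε hε
    obtain ⟨N, hN⟩ := exists_forall_sum_norm_apply_le_of_mem_cohen hp hx (half_pos hε)
    have hle : ∀ n ≥ N, ∀ m ≥ n, X.nrm E ((∑ j ∈ Finset.range m, X.single j (x j)) -
        ∑ j ∈ Finset.range n, X.single j (x j)) < ε := fun n hn m hm => by
      rw [← Finset.sum_Ico_eq_sub _ hm]
      refine lt_of_le_of_lt (nrm_sum_single_le hstable hp1 hp hscalar _ x (hN _ fun j hj => ?_))
        (half_lt_self hε)
      exact hn.le.trans (Finset.mem_Ico.1 hj).1
    refine ⟨N, fun m hm n hn => ?_⟩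
    rcases le_total n m with h | h
    · exact hle n hn m h
    · rw [map_sub_rev]
      exact hle m hm n h)
  have hzx : (z : ℕ → E) = x := by
    funext i
    refine (norm_sub_eq_zero_iff.1 (le_antisymm ?_ (norm_nonneg _))).symm
    -- From `n = i + 1` on, the `i`-th coordinate of the truncation is `x i`.
    refine ge_of_tendsto hz (eventually_atTop.2 ⟨i + 1, fun n hn => ?_⟩)
    have h := X.norm_apply_le E ((∑ j ∈ Finset.range n, X.single j (x j)) - z) i
    rwa [Submodule.coe_sub, Pi.sub_apply, coe_sum_single_apply,
      if_pos (Finset.mem_range.2 hn)] at h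
  subst hzx
  exact ⟨z.2, hz⟩

/-- The Cohen norm bounds the `X(E)` norm of every truncation, and the truncations converge to `x`
in `X(E)`. -/
theorem ofReal_nrm_le_cohenNorm (hstable : X.LinearlyStable) {p : ℝ≥0∞} (hp1 : 1 ≤ p)
    (hp : p ≠ ∞) (hscalar : X.HasScalarComponentLp p) (x : X.space E)
    (hx : (x : ℕ → E) ∈ cohen 𝕜 p E) :
    ENNReal.ofReal (X.nrm E x) ≤ cohenNorm 𝕜 p (x : ℕ → E) := by
  by_cases htop : cohenNorm 𝕜 p (x : ℕ → E) = ∞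
  · rw [htop]
    exact le_top
  obtain ⟨_, hlim⟩ := exists_tendsto_nrm_truncation hstable hp1 hp hscalar hx
  rw [ENNReal.ofReal_le_iff_le_toReal htop]
  refine ge_of_tendsto' (by simpa using hlim.const_add (cohenNorm 𝕜 p (x : ℕ → E)).toReal)
    fun n => ?_
  have h1 := nrm_sum_single_le hstable hp1 hp hscalar (Finset.range n) (x : ℕ → E)
    fun y hy => sum_norm_apply_le_of_cohenNorm_ne_top htop (Finset.range n) hy
  have h2 := map_sub_le_add (X.nrm E) (∑ j ∈ Finset.range n, X.single j ((x : ℕ → E) j))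
    ((∑ j ∈ Finset.range n, X.single j ((x : ℕ → E) j)) - x)
  rw [sub_sub_cancel] at h2
  exact h2.trans (by gcongr)

/-- A linearly stable sequence class with scalar component `ℓ_p` that embeds in the Cohen class is
the Cohen class. -/
theorem LinearlyStable.eqCohen (hstable : X.LinearlyStable) {p : ℝ≥0∞} (hp1 : 1 ≤ p)
    (hp : p ≠ ∞) (hscalar : X.HasScalarComponentLp p) (hembed : X.EmbedsInCohen p) :
    X.EqCohen p := by
  intro E _ _ _
  refine ⟨Set.Subset.antisymm (fun x hx => (hembed E ⟨x, hx⟩).1) fun x hx =>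
    (exists_tendsto_nrm_truncation hstable hp1 hp hscalar hx).1, fun x => ?_⟩
  exact le_antisymm (ofReal_nrm_le_cohenNorm hstable hp1 hp hscalar x (hembed E x).1)
    (hembed E x).2

end SequenceClass

theorem mainTheorem8 {𝕜 : Type u} [RCLike 𝕜] (p : ℝ≥0∞) (hp1 : 1 ≤ p) (hp : p ≠ ∞)
    (X : SequenceClass 𝕜) (hstable : X.LinearlyStable) (hinj : X.FinitelyInjective)
    (hzero : X.FinitelyZeroInvariant) (hshrink : X.FinitelyShrinking)
    (hsph : X.SphericallyComplete) (hscalar : X.HasScalarComponentLp p)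
    (hembed : X.EmbedsInCohen p) :
    X.EqCohen p :=
  hstable.eqCohen hp1 hp hscalar hembed
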